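/- \textbf{Setting.} Let $\mathcal S,\mathcal A$ be finite non-empty sets of states and actions, $S=|\mathcal S|$, $A=|\mathcal A|$, let $R:\mathcal S\times\mathcal A\to[0,1]$ be a known reward function, and let $0\le\gamma\le\gamma_{\rm eval}<1$. For a transition model $P$ (with $P_{s,a}\in\Delta_S$, the probability simplex, for every $(s,a)$), a discount factor $g$ and a policy $\pi:\mathcal S\to\mathcal A$, let $V^\pi_{P,g}(s)=\mathbb E[\sum_{n\ge0}g^nR(s_n,\pi(s_n))\mid s_0=s]$; an optimal policy $\pi^\star_{P,g}$ is a maximiser of $\sum_s\rho(s)V^\pi_{P,g}(s)$ over $\pi$, where $\rho>0$ is any positive weight on $\mathcal S$. Let $T,m\ge1$ and $0\le\sigma$ with $\sigma^2<1$. The tasks $P^1,\dots,P^T$ are drawn independently from a distribution $\mathcal P$ on transition models with mean $P^o$ such that almost surely $\|P^t_{s,a}-P^o_{s,a}\|_\infty\le\sigma$ for all $(s,a)$. For each task $t$ and each $(s,a)$ the learner observes $m$ samples $X^{t,1}_{s,a},\dots,X^{t,m}_{s,a}$ which, given $P^t$, are i.i.d. with law $P^t_{s,a}$; the models and samples of different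 tasks are independent. Put $\bar P^t_{s,a}(s')=\frac1m\sum_{i=1}^m\mathbf 1\{X^{t,i}_{s,a}=s'\}$. The algorithm POMRL($\sigma$), which knows $\sigma$, uses in task $t$ the model $$\hat P^t=(1-\alpha_t)\bar P^t+\alpha_t\hat P^{o,t},$$ where $\hat P^{o,1}$ is uniform, $\alpha_1=0$, and for $t\ge1$ $$\hat P^{o,t+1}=\frac1t\sum_{j=1}^t\bar P^j,\qquad \alpha_{t+1}=\frac1{\sigma^2(1+1/t)m+1}.$$ Let $\mathcal D\subseteq\Delta_S$ be the set of feasible models; it contains, almost surely, all true and all estimated next-state distributions $P^t_{s,a}$ and $\hat P^t_{s,a}$ (for example $\mathcal D=\Delta_S$). Let $\Sigma\le1$ be its diameter in $\|\cdot\|_\infty$. \textbf{Theorem.} There are universal constants $C>0$ and $k\in\mathbb N$ such that, in every such setting and for every $\delta\in(0,1)$, with probability at least $1-\delta$ the average planning loss of POMRL($\sigma$) satisfies $$\frac1T\sum_{t=1}^T\Bigl\|V^{\pi^\star_{P^t,\gamma_{\rm eval}}}_{P^t,\gamma_{\rm eval}}-V^{\pi^\star_{\hat P^t,\gamma}}_{P^t,\gamma_{\rm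 eval}}\Bigr\|_\infty\le\frac{\gamma_{\rm eval}-\gamma}{(1-\gamma_{\rm eval})(1-\gamma)}+\frac{2\gamma S}{(1-\gamma)^2}\,C\Bigl(1+\log\frac{TSA}{\delta}\Bigr)^{k}\left(\frac{\sigma+\sqrt{\tfrac1T}\bigl(\sigma+\sqrt{\sigma^2+\tfrac{\Sigma}{m}}\bigr)}{\sigma^2m+1}+\frac{\sigma^2m\sqrt{\tfrac{\Sigma}{m}}}{\sigma^2m+1}\right),$$ whatever optimal policies are chosen. That is, the last factor is $\tilde O(\cdot)$ of the displayed rate, where $\tilde O$ hides a universal constant and a power of $\log(TSA/\delta)$. -/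

import Mathlib

/-! ### Tabular Markov decision processes -/

section MDP

variable {S A : Type*}

/-- A transition model: `P s a s'` is the probability of moving to `s'` from `s` under `a`. -/
abbrev TransitionModel (S A : Type*) : Type _ := S → A → S → ℝ

/-- The transition matrix of the Markov chain induced by the deterministic policy `π`. -/
def policyMatrix (P : TransitionModel S A) (π : S → A) : Matrix S S ℝ :=
  fun s s' => P s (π s) s'

/-- The value function `V^π_{M,γ}(s) = E[∑ₙ γⁿ R(sₙ, π(sₙ)) | s₀ = s]` of a policy, where the
expected reward after `n` steps from `s` is `(P_πⁿ R_π)(s)`. -/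
noncomputable def valueFn [Fintype S] [DecidableEq S] (P : TransitionModel S A)
    (R : S → A → ℝ) (γ : ℝ) (π : S → A) : S → ℝ :=
  fun s => ∑' n : ℕ, γ ^ n * (policyMatrix P π ^ n).mulVec (fun s' => R s' (π s')) s

/-- `π` is an optimal policy: it maximises `∑ₛ ρ(s) V^π(s)` for some positive weights `ρ`
(in a finite MDP the set of such maximisers does not depend on `ρ`). -/
def IsOptimalPolicy [Fintype S] [DecidableEq S] (P : TransitionModel S A)
    (R : S → A → ℝ) (γ : ℝ) (π : S → A) : Prop :=
  ∃ ρ : S → ℝ, (∀ s, 0 < ρ s) ∧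
    ∀ π' : S → A, ∑ s, ρ s * valueFn P R γ π' s ≤ ∑ s, ρ s * valueFn P R γ π s

/-- The task-averaged loss `(1/T) ∑ₜ ‖V^{πstar t}_{Mₜ,γeval} - V^{πhat t}_{Mₜ,γeval}‖_∞`, the
policies `πstar t` and `πhat t` being evaluated in the model `P t`. It is the average planning
loss when `πstar t` is optimal in `Mₜ` with discount `γeval` and `πhat t` is optimal in the
estimated MDP with discount `γ`. (The norm on `S → ℝ` is the sup norm.) -/
noncomputable def avgPlanningLoss [Fintype S] [DecidableEq S] {T : ℕ}
    (P : Fin T → TransitionModel S A) (R : S → A → ℝ) (γeval : ℝ)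
    (πstar πhat : Fin T → S → A) : ℝ :=
  (1 / (T : ℝ)) *
    ∑ t, ‖valueFn (P t) R γeval (πstar t) - valueFn (P t) R γeval (πhat t)‖

end MDP

/-! ### The sequence of tasks and its samples -/

section Tasks

variable {S A Ω : Type*} {m T : ℕ}

/-- The structural assumption on the task distribution `law`: its draws are transition models, its
mean is `Po`, and almost surely `‖P_{s,a} - Po_{s,a}‖_∞ ≤ σ` for every `(s,a)`. -/
structure TaskSimilarity [Fintype S]
    (law : MeasureTheory.Measure (TransitionModel S A)) (Po : TransitionModel S A) (σ : ℝ) :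
    Prop where
  model : ∀ᵐ p ∂law, ∀ s a, p s a ∈ stdSimplex ℝ S
  mean : ∀ s a s', ∫ p, p s a s' ∂law = Po s a s'
  bounded : ∀ᵐ p ∂law, ∀ s a, ‖p s a - Po s a‖ ≤ σ

/-- The data of `T` tasks: the models `P t` are drawn from `law`; for every `(s,a)`, conditionally
on `P t`, the samples `X t · s a i`, `i < m`, are i.i.d. with law `P t · s a`; and the pairs
(model, samples) of distinct tasks are independent. No assumption is made on the joint law of the
samples of distinct state-action pairs of a task. -/
structure IsTaskStream [MeasurableSpace S] [MeasurableSpace Ω]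
    (μ : MeasureTheory.Measure Ω) (law : MeasureTheory.Measure (TransitionModel S A))
    (P : Fin T → Ω → TransitionModel S A) (X : Fin T → Ω → S → A → Fin m → S) : Prop where
  measurable_model : ∀ t, Measurable (P t)
  measurable_sample : ∀ t, Measurable (X t)
  law_model : ∀ t, μ.map (P t) = law
  law_sample : ∀ t s a (x : Fin m → S) (B : Set (TransitionModel S A)), MeasurableSet B →
    μ {ω | P t ω ∈ B ∧ X t ω s a = x} =
      ∫⁻ p in B, ∏ i, ENNReal.ofReal (p s a (x i)) ∂law
  indep : ProbabilityTheory.iIndepFun (fun t ω => (P t ω, X t ω)) μ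

end Tasks

/-! ### The algorithm -/

section Algorithm

variable {S A : Type*} {m T : ℕ}

/-- The empirical model `P̄_{s,a}(s') = (1/m) ∑ᵢ 1{X^i_{s,a} = s'}` of one task. -/
noncomputable def empiricalModel [DecidableEq S] (x : S → A → Fin m → S) :
    TransitionModel S A :=
  fun s a s' => (∑ i, if x s a i = s' then (1 : ℝ) else 0) / m

/-- The meta-learned initialization. Tasks are numbered from `0`: it is the uniform model for the
first task, and the average of the `t` previous empirical models for task `t ≥ 1`. -/
noncomputable def metaInit [Fintype S] [DecidableEq S] (x : Fin T → S → A → Fin m → S)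
    (t : Fin T) : TransitionModel S A :=
  fun s a s' =>
    if (t : ℕ) = 0 then 1 / (Fintype.card S : ℝ)
    else (1 / ((t : ℕ) : ℝ)) * ∑ j ∈ Finset.Iio t, empiricalModel (x j) s a s'

/-- The mixing rate. Tasks are numbered from `0`: it is `0` for the first task and
`1 / (σ² (1 + 1/t) m + 1)` for task `t ≥ 1`, the one that follows `t` completed tasks. -/
noncomputable def mixingRate (σ : ℝ) (m t : ℕ) : ℝ :=
  if t = 0 then 0 else 1 / (σ ^ 2 * (1 + 1 / (t : ℝ)) * m + 1)

/-- The model estimate `P̂ᵗ = (1 - αₜ) P̄ᵗ + αₜ P̂^{o,t}` of `POMRL(σ)` in task `t`. -/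
noncomputable def pomrlModel [Fintype S] [DecidableEq S] (σ : ℝ)
    (x : Fin T → S → A → Fin m → S) (t : Fin T) : TransitionModel S A :=
  fun s a s' =>
    (1 - mixingRate σ m t) * empiricalModel (x t) s a s' +
      mixingRate σ m t * metaInit x t s a s'

end Algorithm

/-- The rate inside the `Õ`, as a function of the task similarity `σ`, the diameter `D` of the set
of feasible models, the number `m` of samples per state-action pair and the number `T` of tasks. -/
noncomputable def pomrlRate (σ D : ℝ) (m T : ℕ) : ℝ :=
  (σ + √(1 / T) * (σ + √(σ ^ 2 + D / m))) / (σ ^ 2 * m + 1) +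
    (σ ^ 2 * m * √(D / m)) / (σ ^ 2 * m + 1)

/-! The loss of one task splits into a horizon bias and an estimation error. Shortening the discount
from `γeval` to `γ` costs the first term. Planning in the estimate costs twice the simulation lemma,
that is `2γS/(1-γ)²` times the largest entrywise error of the model (`norm_valueFn_sub_le`).

After the first task, that error is at most `(1-α)` times the sampling noise plus `α` times (`σ`
plus the error of the averaged past models around `Po`). The noise is sub-Gaussian with variance
proxy `1/(4m)`. A past deviation has proxy `1/(4m) + σ²`, and tasks are independent, so the average
over `t` tasks fluctuates at scale `√((1/(4m) + σ²)/t)`. With `α ≤ 1/(σ²m+1)`, `1-α ≤ 2σ²m/(σ²m+1)`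
and `∑ 1/√t ≤ 2√T`, averaging over tasks gives the rate (`exists_bad_event`,
`abs_sub_pomrlModel_le`, `average_error_le`).

These bounds do not see the diameter of `D`, so it must be bounded below. The first estimate is
purely empirical, hence it equals a vertex of the simplex with positive probability as soon as the
corresponding next state is charged. If two distinct next states are charged, `D` contains two
vertices and has diameter at least `1`. Otherwise all transitions lead to one state, every estimate
is exact and only the horizon bias remains (`one_le_diam_or_ae_pomrlModel_eq`). -/

/-! ### Discounted values: comparison, optimality and perturbation -/

section MDPTheory

open Finset

variable {S A : Type*}

lemma sum_mul_le_of_mem_stdSimplex [Fintype S] {p u : S → ℝ} {c : ℝ} (hp : p ∈ stdSimplex ℝ S)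
    (hu : ∀ s, u s ≤ c) : ∑ s, p s * u s ≤ c := by
  calc ∑ s, p s * u s ≤ ∑ s, p s * c :=
        sum_le_sum fun s _ => mul_le_mul_of_nonneg_left (hu s) (hp.1 s)
    _ = c := by rw [← sum_mul, hp.2, one_mul]

lemma le_sum_mul_of_mem_stdSimplex [Fintype S] {p u : S → ℝ} {c : ℝ} (hp : p ∈ stdSimplex ℝ S)
    (hu : ∀ s, c ≤ u s) : c ≤ ∑ s, p s * u s := by
  calc c = ∑ s, p s * c := by rw [← sum_mul, hp.2, one_mul]
    _ ≤ ∑ s, p s * u s := sum_le_sum fun s _ => mul_le_mul_of_nonneg_left (hu s) (hp.1 s)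

/-- The comparison principle for the discounted Poisson equation of a stochastic matrix. -/
lemma nonpos_of_le_discount_mul [Fintype S] {M : S → S → ℝ} {g : ℝ} {w : S → ℝ}
    (hM : ∀ s, M s ∈ stdSimplex ℝ S) (hg0 : 0 ≤ g) (hg1 : g < 1)
    (hw : ∀ s, w s ≤ g * ∑ s', M s s' * w s') (s : S) : w s ≤ 0 := by
  -- At a maximiser `s₀` the inequality reads `w s₀ ≤ g * w s₀`, and `g < 1`.
  obtain ⟨s₀, -, hs₀⟩ := exists_max_image univ w ⟨s, mem_univ s⟩
  have h1 : ∑ s', M s₀ s' * w s' ≤ w s₀ :=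
    sum_mul_le_of_mem_stdSimplex (hM s₀) fun s' => hs₀ s' (mem_univ _)
  have h2 := (hw s₀).trans (mul_le_mul_of_nonneg_left h1 hg0)
  have h3 : w s₀ ≤ 0 := by nlinarith
  exact (hs₀ s (mem_univ s)).trans h3

/-- Approximate version of the comparison principle. -/
lemma le_div_of_le_discount_mul_add [Fintype S] {M : S → S → ℝ} {g b : ℝ} {w : S → ℝ}
    (hM : ∀ s, M s ∈ stdSimplex ℝ S) (hg0 : 0 ≤ g) (hg1 : g < 1)
    (hw : ∀ s, w s ≤ g * ∑ s', M s s' * w s' + b) (s : S) : w s ≤ b / (1 - g) := by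
  have hg : 1 - g ≠ 0 := by linarith
  -- The constant `b / (1 - g)` is the fixed point of `c ↦ g * c + b`; subtracting it removes `b`.
  have := nonpos_of_le_discount_mul (w := fun s => w s - b / (1 - g)) hM hg0 hg1 (fun s => by
    simp only [mul_sub, sum_sub_distrib, ← sum_mul, (hM s).2]
    have hb : b = b / (1 - g) - g * (b / (1 - g)) := by field_simp
    linarith [hw s]) s
  linarith

variable [Fintype S] [DecidableEq S] {P Q : TransitionModel S A} {R : S → A → ℝ} {g : ℝ}
  {π : S → A}

lemma policyMatrix_pow_mulVec_mem_Icc (hP : ∀ s a, P s a ∈ stdSimplex ℝ S) {r : S → ℝ}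
    (hr : ∀ s, r s ∈ Set.Icc (0 : ℝ) 1) (n : ℕ) (s : S) :
    (policyMatrix P π ^ n).mulVec r s ∈ Set.Icc (0 : ℝ) 1 := by
  induction n generalizing s with
  | zero => simpa using hr s
  | succ n ih =>
    rw [pow_succ', ← Matrix.mulVec_mulVec]
    exact ⟨le_sum_mul_of_mem_stdSimplex (hP s (π s)) fun s' => (ih s').1,
      sum_mul_le_of_mem_stdSimplex (hP s (π s)) fun s' => (ih s').2⟩

/-- The Bellman equation of a policy. -/
lemma valueFn_eq (hP : ∀ s a, P s a ∈ stdSimplex ℝ S) (hR : ∀ s a, R s a ∈ Set.Icc (0 : ℝ) 1)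
    (hg0 : 0 ≤ g) (hg1 : g < 1) (s : S) :
    valueFn P R g π s = R s (π s) + g * ∑ s', P s (π s) s' * valueFn P R g π s' := by
  have hsum : ∀ s, Summable fun n : ℕ =>
      g ^ n * (policyMatrix P π ^ n).mulVec (fun s' => R s' (π s')) s := fun s => by
    refine Summable.of_nonneg_of_le (fun n => ?_) (fun n => ?_)
      (summable_geometric_of_lt_one hg0 hg1)
    · exact mul_nonneg (pow_nonneg hg0 n)
        (policyMatrix_pow_mulVec_mem_Icc hP (fun s => hR s (π s)) n s).1
    · exact mul_le_of_le_one_right (pow_nonneg hg0 n)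
        (policyMatrix_pow_mulVec_mem_Icc hP (fun s => hR s (π s)) n s).2
  simp only [valueFn]
  rw [(hsum s).tsum_eq_zero_add]
  simp only [← tsum_mul_left]
  rw [← Summable.tsum_finsetSum fun s' _ => (hsum s').mul_left _, ← tsum_mul_left]
  congr 1
  · simp
  · refine tsum_congr fun n => ?_
    rw [pow_succ' (policyMatrix P π), ← Matrix.mulVec_mulVec, pow_succ', mul_assoc]
    congr 1
    rw [Matrix.mulVec, dotProduct, mul_sum]
    exact sum_congr rfl fun s' _ => by rw [policyMatrix]; ring

lemma valueFn_nonneg (hP : ∀ s a, P s a ∈ stdSimplex ℝ S)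
    (hR : ∀ s a, R s a ∈ Set.Icc (0 : ℝ) 1) (hg0 : 0 ≤ g) (s : S) :
    0 ≤ valueFn P R g π s :=
  tsum_nonneg fun n => mul_nonneg (pow_nonneg hg0 n)
    (policyMatrix_pow_mulVec_mem_Icc hP (fun s => hR s (π s)) n s).1

lemma valueFn_le (hP : ∀ s a, P s a ∈ stdSimplex ℝ S)
    (hR : ∀ s a, R s a ∈ Set.Icc (0 : ℝ) 1) (hg0 : 0 ≤ g) (hg1 : g < 1) (s : S) :
    valueFn P R g π s ≤ 1 / (1 - g) :=
  le_div_of_le_discount_mul_add (fun s => hP s (π s)) hg0 hg1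
    (fun s => by linarith [valueFn_eq (π := π) hP hR hg0 hg1 s, (hR s (π s)).2]) s

/-- A policy that maximises a positively weighted value maximises the value of every state. -/
lemma IsOptimalPolicy.valueFn_le_valueFn (hπ : IsOptimalPolicy P R g π)
    (hP : ∀ s a, P s a ∈ stdSimplex ℝ S) (hR : ∀ s a, R s a ∈ Set.Icc (0 : ℝ) 1)
    (hg0 : 0 ≤ g) (hg1 : g < 1) (π' : S → A) (s : S) :
    valueFn P R g π' s ≤ valueFn P R g π s := by
  obtain ⟨ρ, hρ, hmax⟩ := hπ
  -- Policy improvement: if some action beat `π` at `s₀`, switching to it there alone would raise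
  -- the value strictly at `s₀` and lower it nowhere, hence raise the weighted sum because `ρ > 0`.
  have greedy : ∀ s a, R s a + g * ∑ s', P s a s' * valueFn P R g π s' ≤ valueFn P R g π s := by
    intro s₀ a
    by_contra! hlt
    set π₂ := Function.update π s₀ a with hπ₂
    have step : ∀ s, valueFn P R g π s ≤
        R s (π₂ s) + g * ∑ s', P s (π₂ s) s' * valueFn P R g π s' := by
      intro s
      by_cases hs : s = s₀
      · subst hs; simpa [hπ₂] using hlt.le
      · simpa [hπ₂, hs] using (valueFn_eq (π := π) hP hR hg0 hg1 s).le
    have dom : ∀ s, valueFn P R g π s ≤ valueFn P R g π₂ s := by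
      intro s
      have := nonpos_of_le_discount_mul (w := fun s => valueFn P R g π s - valueFn P R g π₂ s)
        (fun s => hP s (π₂ s)) hg0 hg1 (fun s => by
          have h1 := step s
          have h2 := valueFn_eq (π := π₂) hP hR hg0 hg1 s
          simp only [mul_sub, sum_sub_distrib]
          linarith) s
      linarith
    have strict : valueFn P R g π s₀ < valueFn P R g π₂ s₀ := by
      have h2 := valueFn_eq (π := π₂) hP hR hg0 hg1 s₀
      rw [show π₂ s₀ = a by simp [hπ₂]] at h2
      have h3 : ∑ s', P s₀ a s' * valueFn P R g π s' ≤ ∑ s', P s₀ a s' * valueFn P R g π₂ s' :=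
        sum_le_sum fun s' _ => mul_le_mul_of_nonneg_left (dom s') ((hP s₀ a).1 s')
      linarith [mul_le_mul_of_nonneg_left h3 hg0]
    refine (hmax π₂).not_gt (sum_lt_sum (fun s _ => ?_) ⟨s₀, mem_univ _, ?_⟩)
    · exact mul_le_mul_of_nonneg_left (dom s) (hρ s).le
    · exact mul_lt_mul_of_pos_left strict (hρ s₀)
  have := nonpos_of_le_discount_mul (w := fun s => valueFn P R g π' s - valueFn P R g π s)
    (fun s => hP s (π' s)) hg0 hg1 (fun s => by
      have h1 := greedy s (π' s)
      have h2 := valueFn_eq (π := π') hP hR hg0 hg1 s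
      simp only [mul_sub, sum_sub_distrib]
      linarith) s
  linarith

/-- The simulation lemma: values depend on the model in a Lipschitz way. -/
lemma valueFn_sub_le_of_model_close (hP : ∀ s a, P s a ∈ stdSimplex ℝ S)
    (hQ : ∀ s a, Q s a ∈ stdSimplex ℝ S) (hR : ∀ s a, R s a ∈ Set.Icc (0 : ℝ) 1)
    (hg0 : 0 ≤ g) (hg1 : g < 1) {ε : ℝ} (hε : ∀ s a s', |P s a s' - Q s a s'| ≤ ε) (s : S) :
    valueFn P R g π s - valueFn Q R g π s ≤ g * Fintype.card S / (1 - g) ^ 2 * ε := by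
  have hg : 0 < 1 - g := by linarith
  -- The difference solves a Poisson equation for `Q`, with source `g (P - Q) V_P`; here `0 ≤ V_P ≤
  -- 1/(1-g)` and each of the `S` entries of `P - Q` is at most `ε`.
  have key := le_div_of_le_discount_mul_add
    (w := fun s => valueFn P R g π s - valueFn Q R g π s)
    (b := g * (Fintype.card S * (ε * (1 / (1 - g)))))
    (fun s => hQ s (π s)) hg0 hg1 (fun s => by
      have h1 := valueFn_eq (π := π) hP hR hg0 hg1 s
      have h2 := valueFn_eq (π := π) hQ hR hg0 hg1 s
      have h3 : ∑ s', (P s (π s) s' - Q s (π s) s') * valueFn P R g π s' ≤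
          Fintype.card S * (ε * (1 / (1 - g))) := by
        rw [← nsmul_eq_mul, ← card_univ]
        refine sum_le_card_nsmul _ _ _ fun s' _ => ?_
        have hV := valueFn_nonneg (π := π) hP hR hg0 s'
        have hε0 := (abs_nonneg _).trans (hε s (π s) s')
        calc _ ≤ ε * valueFn P R g π s' :=
              mul_le_mul_of_nonneg_right ((le_abs_self _).trans (hε _ _ _)) hV
          _ ≤ _ := mul_le_mul_of_nonneg_left (valueFn_le hP hR hg0 hg1 s') hε0
      have h4 := mul_le_mul_of_nonneg_left h3 hg0
      simp only [sub_mul, mul_sub, sum_sub_distrib] at h4 ⊢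
      linarith) s
  calc _ ≤ _ := key
    _ = _ := by field_simp

/-- Rewards are nonnegative, so a longer horizon only adds value: the source `(g - g') P_π V_{g'}`
of the equation for the difference is nonpositive. -/
lemma valueFn_le_of_discount_le (hP : ∀ s a, P s a ∈ stdSimplex ℝ S)
    (hR : ∀ s a, R s a ∈ Set.Icc (0 : ℝ) 1) {g' : ℝ} (hg0 : 0 ≤ g) (hg : g ≤ g') (hg1 : g' < 1)
    (s : S) : valueFn P R g π s ≤ valueFn P R g' π s := by
  have := nonpos_of_le_discount_mul (w := fun s => valueFn P R g π s - valueFn P R g' π s)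
    (fun s => hP s (π s)) hg0 (hg.trans_lt hg1) (fun s => by
      have h1 := valueFn_eq (π := π) hP hR hg0 (hg.trans_lt hg1) s
      have h2 := valueFn_eq (π := π) hP hR (hg0.trans hg) hg1 s
      have h3 : 0 ≤ ∑ s', P s (π s) s' * valueFn P R g' π s' :=
        le_sum_mul_of_mem_stdSimplex (hP s (π s))
          fun s' => valueFn_nonneg hP hR (hg0.trans hg) s'
      simp only [mul_sub, sum_sub_distrib]
      nlinarith [mul_le_mul_of_nonneg_right hg h3]) s
  linarith

/-- The difference solves the Poisson equation with discount `g'` and source `(g' - g) P_π V_g`,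
where `V_g ≤ 1/(1-g)`. -/
lemma valueFn_sub_le_of_discount_le (hP : ∀ s a, P s a ∈ stdSimplex ℝ S)
    (hR : ∀ s a, R s a ∈ Set.Icc (0 : ℝ) 1) {g' : ℝ} (hg0 : 0 ≤ g) (hg : g ≤ g') (hg1 : g' < 1)
    (s : S) :
    valueFn P R g' π s - valueFn P R g π s ≤ (g' - g) / ((1 - g') * (1 - g)) := by
  have key := le_div_of_le_discount_mul_add
    (w := fun s => valueFn P R g' π s - valueFn P R g π s) (b := (g' - g) * (1 / (1 - g)))
    (fun s => hP s (π s)) (hg0.trans hg) hg1 (fun s => by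
      have h1 := valueFn_eq (π := π) hP hR hg0 (hg.trans_lt hg1) s
      have h2 := valueFn_eq (π := π) hP hR (hg0.trans hg) hg1 s
      have h3 : ∑ s', P s (π s) s' * valueFn P R g π s' ≤ 1 / (1 - g) :=
        sum_mul_le_of_mem_stdSimplex (hP s (π s))
          fun s' => valueFn_le hP hR hg0 (hg.trans_lt hg1) s'
      simp only [mul_sub, sum_sub_distrib]
      nlinarith [mul_le_mul_of_nonneg_left h3 (sub_nonneg.2 hg)]) s
  calc _ ≤ _ := key
    _ = _ := by
      have : 1 - g' ≠ 0 := by linarith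
      have : 1 - g ≠ 0 := by linarith
      field_simp

/-- The planning loss of the certainty-equivalent policy of an estimated model, computed with a
shorter horizon. -/
lemma norm_valueFn_sub_le (hP : ∀ s a, P s a ∈ stdSimplex ℝ S)
    (hQ : ∀ s a, Q s a ∈ stdSimplex ℝ S) (hR : ∀ s a, R s a ∈ Set.Icc (0 : ℝ) 1)
    {g' : ℝ} (hg0 : 0 ≤ g) (hg : g ≤ g') (hg1 : g' < 1) {ε : ℝ} (hε0 : 0 ≤ ε)
    (hε : ∀ s a s', |P s a s' - Q s a s'| ≤ ε) {πstar πhat : S → A}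
    (hstar : IsOptimalPolicy P R g' πstar) (hhat : IsOptimalPolicy Q R g πhat) :
    ‖valueFn P R g' πstar - valueFn P R g' πhat‖ ≤
      (g' - g) / ((1 - g') * (1 - g)) + 2 * g * Fintype.card S / (1 - g) ^ 2 * ε := by
  have hg1' := hg.trans_lt hg1
  refine (pi_norm_le_iff_of_nonneg ?_).2 fun s => ?_
  · have : 0 < 1 - g' := by linarith
    have : 0 < 1 - g := by linarith
    have : 0 ≤ g' - g := by linarith
    positivity
  · rw [Pi.sub_apply, Real.norm_eq_abs, abs_of_nonneg
      (sub_nonneg.2 (hstar.valueFn_le_valueFn hP hR (hg0.trans hg) hg1 πhat s))]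
    -- Chain of comparisons: `πstar` from `g'` to `g` in `P`, then from `P` to `Q`; `πhat` beats it
    -- in `Q`; then `πhat` from `Q` back to `P`, and from `g` up to `g'` at no cost.
    have h1 := valueFn_sub_le_of_discount_le (π := πstar) hP hR hg0 hg hg1 s
    have h2 := valueFn_le_of_discount_le (π := πhat) hP hR hg0 hg hg1 s
    have h3 := hhat.valueFn_le_valueFn hQ hR hg0 hg1' πstar s
    have h4 := valueFn_sub_le_of_model_close (π := πstar) hP hQ hR hg0 hg1' hε s
    have h5 := valueFn_sub_le_of_model_close (π := πhat) hQ hP hR hg0 hg1'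
      (fun s a s' => by rw [abs_sub_comm]; exact hε s a s') s
    have h6 : 2 * g * Fintype.card S / (1 - g) ^ 2 * ε =
      2 * (g * Fintype.card S / (1 - g) ^ 2 * ε) := by ring
    linarith

end MDPTheory

set_option linter.unusedSectionVars false

/-! ### Exponential moments of sampling noise and task deviations -/

section Concentration

open MeasureTheory ProbabilityTheory Finset
open scoped ENNReal NNReal

/-- Hoeffding's lemma for the indicator of a point under a probability vector. -/
lemma sum_mul_exp_indicator_le {S : Type*} [Fintype S] [DecidableEq S] {p : S → ℝ}
    (hp : p ∈ stdSimplex ℝ S) (y : S) (t : ℝ) :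
    ∑ z, p z * Real.exp (t * ((if z = y then 1 else 0) - p y)) ≤ Real.exp (t ^ 2 / 8) := by
  let _ : MeasurableSpace S := ⊤
  have : DiscreteMeasurableSpace S := ⟨fun _ => trivial⟩
  let q : PMF S := PMF.ofFintype (fun z => ENNReal.ofReal (p z)) (by
    rw [← ENNReal.ofReal_sum_of_nonneg fun z _ => hp.1 z, hp.2, ENNReal.ofReal_one])
  have hq : ∀ z, (q z).toReal = p z := fun z => by
    exact ENNReal.toReal_ofReal (hp.1 z)
  have h := (hasSubgaussianMGF_of_mem_Icc (μ := q.toMeasure) (a := 0) (b := 1)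
    (X := fun z => if z = y then (1 : ℝ) else 0) (measurable_of_finite _).aemeasurable
    (Filter.Eventually.of_forall fun z => by
      split_ifs <;> simp)).mgf_le t
  rw [mgf, PMF.integral_eq_sum, PMF.integral_eq_sum] at h
  simp only [hq, smul_eq_mul, mul_ite, mul_one, mul_zero, sum_ite_eq', mem_univ, if_true] at h
  refine h.trans (le_of_eq ?_)
  congr 1
  simp
  ring

variable {S A Ω : Type*} {m T : ℕ} [Fintype S] [DecidableEq S]
  [MeasurableSpace S] [DiscreteMeasurableSpace S] [MeasurableSpace Ω] {μ : Measure Ω}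
  {law : Measure (TransitionModel S A)} {P : Fin T → Ω → TransitionModel S A}
  {X : Fin T → Ω → S → A → Fin m → S} {Po : TransitionModel S A} {σ : ℝ}

lemma measurable_entry (s : S) (a : A) (y : S) :
    Measurable fun p : TransitionModel S A => p s a y :=
  (measurable_pi_apply y).comp ((measurable_pi_apply a).comp (measurable_pi_apply s))

lemma measurable_sample_entry (s : S) (a : A) :
    Measurable fun x : S → A → Fin m → S => x s a :=
  (measurable_pi_apply a).comp (measurable_pi_apply s)

lemma measurable_empiricalModel_entry (s : S) (a : A) (y : S) :
    Measurable fun x : S → A → Fin m → S => empiricalModel x s a y :=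
  (measurable_of_finite
    (fun z : Fin m → S => (∑ i, if z i = y then (1 : ℝ) else 0) / m)).comp
    (measurable_sample_entry s a)

namespace IsTaskStream

/-- The joint law of the model and of the samples of one state-action pair. -/
lemma lintegral_eq (h : IsTaskStream μ law P X) (t : Fin T) (s : S) (a : A)
    {f : TransitionModel S A → (Fin m → S) → ℝ≥0∞} (hf : ∀ x, Measurable fun p => f p x) :
    ∫⁻ ω, f (P t ω) (X t ω s a) ∂μ =
      ∑ x : Fin m → S, ∫⁻ p, (∏ i, ENNReal.ofReal (p s a (x i))) * f p x ∂law := by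
  have hX : Measurable fun ω => X t ω s a :=
    (measurable_sample_entry s a).comp (h.measurable_sample t)
  have hset : ∀ x : Fin m → S, MeasurableSet {ω | X t ω s a = x} := fun x =>
    hX (measurableSet_singleton x)
  have hd : ∀ x : Fin m → S,
      Measurable fun p : TransitionModel S A => ∏ i, ENNReal.ofReal (p s a (x i)) := fun x =>
    Finset.measurable_fun_prod _ fun i _ => (measurable_entry s a (x i)).ennreal_ofReal
  -- On the event that the sample vector is `x`, the model has the likelihood of `x` as density with
  -- respect to `law`.
  have hmap : ∀ x : Fin m → S, (μ.restrict {ω | X t ω s a = x}).map (P t) =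
      law.withDensity fun p => ∏ i, ENNReal.ofReal (p s a (x i)) := fun x => by
    ext B hB
    rw [Measure.map_apply (h.measurable_model t) hB,
      Measure.restrict_apply (h.measurable_model t hB), withDensity_apply _ hB,
      ← h.law_sample t s a x B hB]
    rfl
  calc ∫⁻ ω, f (P t ω) (X t ω s a) ∂μ
      = ∫⁻ ω, ∑ x, {ω | X t ω s a = x}.indicator (fun ω => f (P t ω) x) ω ∂μ := by
        refine lintegral_congr fun ω => ?_
        simp [Set.indicator_apply]
    _ = ∑ x, ∫⁻ ω in {ω | X t ω s a = x}, f (P t ω) x ∂μ := by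
        refine (lintegral_finsetSum _ fun x _ =>
          ((hf x).comp (h.measurable_model t)).indicator (hset x)).trans ?_
        exact sum_congr rfl fun x _ => lintegral_indicator (hset x) _
    _ = _ := by
        refine sum_congr rfl fun x _ => ?_
        rw [← lintegral_map (hf x) (h.measurable_model t), hmap x,
          lintegral_withDensity_eq_lintegral_mul _ (hd x) (hf x)]
        rfl

lemma isProbabilityMeasure_law [IsProbabilityMeasure μ] (h : IsTaskStream μ law P X)
    (t : Fin T) : IsProbabilityMeasure law := by
  rw [← h.law_model t]
  exact Measure.isProbabilityMeasure_map (h.measurable_model t).aemeasurable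

lemma ae_model (h : IsTaskStream μ law P X) (hlaw : TaskSimilarity law Po σ) (t : Fin T) :
    ∀ᵐ ω ∂μ, ∀ s a, P t ω s a ∈ stdSimplex ℝ S := by
  have := hlaw.model
  rw [← h.law_model t] at this
  exact ae_of_ae_map (h.measurable_model t).aemeasurable this

lemma ae_norm_sub_le (h : IsTaskStream μ law P X) (hlaw : TaskSimilarity law Po σ) (t : Fin T) :
    ∀ᵐ ω ∂μ, ∀ s a, ‖P t ω s a - Po s a‖ ≤ σ := by
  have := hlaw.bounded
  rw [← h.law_model t] at this
  exact ae_of_ae_map (h.measurable_model t).aemeasurable this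

/-- The joint exponential moment of the sampling noise and of a function of the model. -/
lemma lintegral_exp_le (h : IsTaskStream μ law P X) (hlaw : TaskSimilarity law Po σ)
    (hm : 1 ≤ m) (t : Fin T) (s : S) (a : A) (y : S) (u : ℝ) {f : TransitionModel S A → ℝ}
    (hf : Measurable f) :
    ∫⁻ ω, ENNReal.ofReal
        (Real.exp (u * (empiricalModel (X t ω) s a y - P t ω s a y) + f (P t ω))) ∂μ ≤
      ENNReal.ofReal (Real.exp (u ^ 2 / (8 * m))) *
        ∫⁻ p, ENNReal.ofReal (Real.exp (f p)) ∂law := by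
  have hm0 : (m : ℝ) ≠ 0 := by positivity
  let F : TransitionModel S A → (Fin m → S) → ℝ := fun p x =>
    Real.exp (u * ((∑ i, if x i = y then (1 : ℝ) else 0) / m - p s a y) + f p)
  have hF : ∀ x, Measurable fun p => F p x := fun x =>
    Real.measurable_exp.comp
      ((((measurable_entry s a y).const_sub _).const_mul u).add hf)
  have hd : ∀ x : Fin m → S,
      Measurable fun p : TransitionModel S A => ∏ i, ENNReal.ofReal (p s a (x i)) := fun x =>
    Finset.measurable_fun_prod _ fun i _ => (measurable_entry s a (x i)).ennreal_ofReal
  calc _ = ∫⁻ ω, ENNReal.ofReal (F (P t ω) (X t ω s a)) ∂μ := rfl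
    _ = _ := h.lintegral_eq t s a (f := fun p x => ENNReal.ofReal (F p x))
        fun x => (hF x).ennreal_ofReal
    _ = ∫⁻ p, ∑ x : Fin m → S,
          (∏ i, ENNReal.ofReal (p s a (x i))) * ENNReal.ofReal (F p x) ∂law :=
        (lintegral_finsetSum _ fun x _ => (hd x).mul (hF x).ennreal_ofReal).symm
    _ ≤ ∫⁻ p, ENNReal.ofReal (Real.exp (u ^ 2 / (8 * m))) *
          ENNReal.ofReal (Real.exp (f p)) ∂law := by
        refine lintegral_mono_ae ?_
        filter_upwards [hlaw.model] with p hp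
        have hp := hp s a
        have key : ∑ x : Fin m → S, (∏ i, p s a (x i)) * F p x ≤
            Real.exp (u ^ 2 / (8 * m)) * Real.exp (f p) := by
          -- For a fixed model the samples are independent, so the weight factorises and the sum
          -- over sample vectors is an `m`-th power of the one-sample moment, with parameter `u /
          -- m`.
          have hfac : ∀ x : Fin m → S, (∏ i, p s a (x i)) * F p x =
              (∏ i, p s a (x i) *
                Real.exp (u / m * ((if x i = y then 1 else 0) - p s a y))) * Real.exp (f p) := by
            intro x
            rw [prod_mul_distrib, ← Real.exp_sum, mul_assoc, ← Real.exp_add]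
            congr 1
            refine congrArg Real.exp (congrArg (· + f p) ?_)
            rw [← mul_sum, sum_sub_distrib]
            simp only [sum_const, card_univ, Fintype.card_fin, nsmul_eq_mul]
            field_simp
          rw [sum_congr rfl fun x _ => hfac x, ← sum_mul]
          refine mul_le_mul_of_nonneg_right ?_ (Real.exp_pos _).le
          have hpow := Fintype.sum_pow
            (fun z => p s a z * Real.exp (u / m * ((if z = y then 1 else 0) - p s a y))) m
          rw [← hpow]
          calc _ ≤ (Real.exp ((u / m) ^ 2 / 8)) ^ m :=
                pow_le_pow_left₀
                  (sum_nonneg fun z _ => mul_nonneg (hp.1 z) (Real.exp_pos _).le)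
                  (sum_mul_exp_indicator_le hp y (u / m)) m
            _ = _ := by
                rw [← Real.exp_nat_mul]
                congr 1
                field_simp
        rw [← ENNReal.ofReal_mul (Real.exp_pos _).le]
        refine le_trans (le_of_eq ?_) (ENNReal.ofReal_le_ofReal key)
        rw [ENNReal.ofReal_sum_of_nonneg fun x _ =>
          mul_nonneg (prod_nonneg fun i _ => hp.1 _) (Real.exp_pos _).le]
        refine sum_congr rfl fun x _ => ?_
        rw [ENNReal.ofReal_mul (prod_nonneg fun i _ => hp.1 _),
          ENNReal.ofReal_prod_of_nonneg fun i _ => hp.1 _]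
    _ = _ := lintegral_const_mul _ (Real.measurable_exp.comp hf).ennreal_ofReal

/-- A bound on the exponential Lebesgue integrals makes a random variable sub-Gaussian. -/
lemma _root_.hasSubgaussianMGF_of_lintegral_le {Z : Ω → ℝ} (hZ : Measurable Z) {c : ℝ≥0}
    (hle : ∀ u : ℝ, ∫⁻ ω, ENNReal.ofReal (Real.exp (u * Z ω)) ∂μ ≤
      ENNReal.ofReal (Real.exp (c * u ^ 2 / 2))) : HasSubgaussianMGF Z c μ where
  integrable_exp_mul u := by
    refine ⟨(Real.measurable_exp.comp (hZ.const_mul u)).aestronglyMeasurable, ?_⟩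
    rw [hasFiniteIntegral_iff_ofReal (Filter.Eventually.of_forall fun ω => (Real.exp_pos _).le)]
    exact (hle u).trans_lt ENNReal.ofReal_lt_top
  mgf_le u := by
    rw [mgf, integral_eq_lintegral_of_nonneg_ae
      (Filter.Eventually.of_forall fun ω => (Real.exp_pos _).le)
      (Real.measurable_exp.comp (hZ.const_mul u)).aestronglyMeasurable]
    exact ENNReal.toReal_le_of_le_ofReal (Real.exp_pos _).le (hle u)

lemma measurable_noise (h : IsTaskStream μ law P X) (t : Fin T) (s : S) (a : A) (y : S) :
    Measurable fun ω => empiricalModel (X t ω) s a y - P t ω s a y :=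
  ((measurable_empiricalModel_entry s a y).comp (h.measurable_sample t)).sub
    ((measurable_entry s a y).comp (h.measurable_model t))

lemma measurable_deviation (h : IsTaskStream μ law P X) (t : Fin T) (s : S) (a : A) (y : S) :
    Measurable fun ω => empiricalModel (X t ω) s a y - Po s a y :=
  ((measurable_empiricalModel_entry s a y).comp (h.measurable_sample t)).sub_const _

/-- The sampling noise is sub-Gaussian. -/
lemma hasSubgaussianMGF_noise [IsProbabilityMeasure μ] (h : IsTaskStream μ law P X)
    (hlaw : TaskSimilarity law Po σ) (hm : 1 ≤ m) (t : Fin T) (s : S) (a : A) (y : S) :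
    HasSubgaussianMGF (fun ω => empiricalModel (X t ω) s a y - P t ω s a y)
      (1 / (4 * m)) μ := by
  have := h.isProbabilityMeasure_law t
  refine hasSubgaussianMGF_of_lintegral_le (h.measurable_noise t s a y) fun u => ?_
  have := h.lintegral_exp_le hlaw hm t s a y u (f := fun _ => 0) measurable_const
  simp only [add_zero, Real.exp_zero, ENNReal.ofReal_one, lintegral_const, measure_univ,
    mul_one] at this
  refine this.trans (le_of_eq ?_)
  congr 2
  push_cast
  ring

/-- The deviation of an empirical model from the mean model is sub-Gaussian. -/
lemma hasSubgaussianMGF_deviation [IsProbabilityMeasure μ] (h : IsTaskStream μ law P X)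
    (hlaw : TaskSimilarity law Po σ) (hm : 1 ≤ m) (t : Fin T) (s : S) (a : A) (y : S) :
    HasSubgaussianMGF (fun ω => empiricalModel (X t ω) s a y - Po s a y)
      (1 / (4 * m) + σ.toNNReal ^ 2) μ := by
  have := h.isProbabilityMeasure_law t
  have hσ : 0 ≤ σ := by
    obtain ⟨p, hp⟩ := hlaw.bounded.exists
    exact (norm_nonneg _).trans (hp s a)
  refine hasSubgaussianMGF_of_lintegral_le (h.measurable_deviation t s a y) fun u => ?_
  have hm1 : Measurable fun p : TransitionModel S A => p s a y := measurable_entry s a y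
  -- The deviation is noise plus `P - Po`. The second part is a function of the model, centred with
  -- range of length `2σ`, so Hoeffding's lemma adds `σ²` to the proxy.
  have h1 := h.lintegral_exp_le hlaw hm t s a y u (f := fun p => u * (p s a y - Po s a y))
    ((hm1.sub_const _).const_mul u)
  have hb : ∀ᵐ p ∂law, p s a y ∈ Set.Icc (Po s a y - σ) (Po s a y + σ) := by
    filter_upwards [hlaw.bounded] with p hp
    have := (norm_le_pi_norm (p s a - Po s a) y).trans (hp s a)
    rw [Pi.sub_apply, Real.norm_eq_abs, abs_le] at this
    constructor <;> linarith
  have h2 := hasSubgaussianMGF_of_mem_Icc hm1.aemeasurable hb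
  rw [hlaw.mean s a y] at h2
  have h3 := h2.mgf_le u
  rw [mgf] at h3
  have h4 : ∫⁻ p, ENNReal.ofReal (Real.exp (u * (p s a y - Po s a y))) ∂law ≤
      ENNReal.ofReal (Real.exp (σ ^ 2 * u ^ 2 / 2)) := by
    rw [← ofReal_integral_eq_lintegral_ofReal (h2.integrable_exp_mul u)
      (Filter.Eventually.of_forall fun ω => (Real.exp_pos _).le)]
    refine ENNReal.ofReal_le_ofReal (h3.trans (le_of_eq ?_))
    congr 3
    push_cast
    rw [show Po s a y + σ - (Po s a y - σ) = 2 * σ by ring, Real.norm_eq_abs,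
      abs_of_nonneg (by positivity)]
    ring
  calc _ = _ := by
        refine lintegral_congr fun ω => ?_
        congr 2
        ring
    _ ≤ _ := h1.trans (mul_le_mul_right h4 _)
    _ = _ := by
        rw [← ENNReal.ofReal_mul (Real.exp_pos _).le, ← Real.exp_add]
        congr 2
        push_cast
        rw [Real.coe_toNNReal σ hσ]
        field_simp
        ring

/-- Deviations in distinct tasks are independent. -/
lemma iIndepFun_deviation (h : IsTaskStream μ law P X) (s : S) (a : A) (y : S) :
    iIndepFun (fun t ω => empiricalModel (X t ω) s a y - Po s a y) μ :=
  h.indep.comp (fun _ z => empiricalModel z.2 s a y - Po s a y) fun _ =>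
    ((measurable_empiricalModel_entry s a y).comp measurable_snd).sub_const _

end IsTaskStream

end Concentration

/-! ### Lower bound on the diameter of the feasible set -/

section Feasible

open MeasureTheory ProbabilityTheory Finset
open scoped ENNReal NNReal

variable {S A Ω : Type*} {m T : ℕ} [Fintype S] [DecidableEq S]
  [MeasurableSpace S] [DiscreteMeasurableSpace S] [MeasurableSpace Ω] {μ : Measure Ω}
  {law : Measure (TransitionModel S A)} {P : Fin T → Ω → TransitionModel S A}
  {X : Fin T → Ω → S → A → Fin m → S} {Po : TransitionModel S A} {σ : ℝ}

lemma empiricalModel_of_const (hm : 1 ≤ m) {x : S → A → Fin m → S} {s : S} {a : A} {y : S}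
    (hx : x s a = fun _ => y) : empiricalModel x s a = Pi.single y 1 := by
  have hm0 : (m : ℝ) ≠ 0 := by positivity
  ext z
  by_cases h : y = z
  · subst h; simp [empiricalModel, hx, hm0]
  · simp [empiricalModel, hx, h, Ne.symm h]

lemma pomrlModel_zero {x : Fin T → S → A → Fin m → S} {t : Fin T} (ht : (t : ℕ) = 0) :
    pomrlModel σ x t = empiricalModel (x t) := by
  ext s a z
  simp [pomrlModel, mixingRate, ht]

lemma pomrlModel_of_const (hm : 1 ≤ m) {x : Fin T → S → A → Fin m → S} {s : S} {a : A} {y : S}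
    (hx : ∀ t, x t s a = fun _ => y) (t : Fin T) : pomrlModel σ x t s a = Pi.single y 1 := by
  by_cases ht : (t : ℕ) = 0
  · rw [pomrlModel_zero ht, empiricalModel_of_const hm (hx t)]
  · ext z
    have ht' : ((t : ℕ) : ℝ) ≠ 0 := by exact_mod_cast ht
    simp only [pomrlModel, metaInit, ht, if_false, empiricalModel_of_const hm (hx _), sum_const,
      Fin.card_Iio, nsmul_eq_mul]
    field_simp
    ring

namespace IsTaskStream

/-- A next state of positive probability is the only one sampled with positive probability, so the
corresponding vertex of the simplex is the empirical model of the first task and is feasible. -/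
lemma single_mem_of_charged (h : IsTaskStream μ law P X) (hlaw : TaskSimilarity law Po σ)
    (hm : 1 ≤ m) (hT : 1 ≤ T) {D : Set (S → ℝ)}
    (hD : ∀ᵐ ω ∂μ, ∀ t s a, pomrlModel σ (fun j => X j ω) t s a ∈ D) {s : S} {a : A} {y : S}
    (hy : ¬ ∀ᵐ p ∂law, p s a y = 0) : Pi.single y 1 ∈ D := by
  by_contra hmem
  refine hy ?_
  -- On this event the first estimate is the vertex at `y`, which is not in `D`, so the event is
  -- null. Its probability is the integral of `(p s a y) ^ m`, which forces `p s a y = 0` almost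
  -- everywhere.
  have h0 : μ {ω | P ⟨0, hT⟩ ω ∈ Set.univ ∧ X ⟨0, hT⟩ ω s a = fun _ => y} = 0 := by
    refine measure_mono_null (fun ω hω => ?_) (ae_iff.1 hD)
    intro hgood
    refine hmem ?_
    have := hgood ⟨0, hT⟩ s a
    rwa [pomrlModel_zero rfl, empiricalModel_of_const hm hω.2] at this
  rw [h.law_sample _ s a _ _ MeasurableSet.univ, Measure.restrict_univ,
    lintegral_eq_zero_iff (Finset.measurable_fun_prod _ fun i _ =>
      (measurable_entry s a y).ennreal_ofReal)] at h0
  filter_upwards [h0, hlaw.model] with p hp hmod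
  simp only [prod_const, card_univ, Fintype.card_fin, Pi.zero_apply] at hp
  have := ENNReal.ofReal_eq_zero.1 (pow_eq_zero_iff (by omega) |>.1 hp)
  exact le_antisymm this ((hmod s a).1 y)

/-- The set of feasible models has diameter at least `1`, unless transitions are deterministic
and all lead to the same state, in which case every estimate is exact. -/
lemma one_le_diam_or_ae_pomrlModel_eq [Nonempty S] [Fintype A] [Nonempty A]
    [IsProbabilityMeasure μ] (h : IsTaskStream μ law P X) (hlaw : TaskSimilarity law Po σ)
    (hm : 1 ≤ m) (hT : 1 ≤ T) {D : Set (S → ℝ)} (hDsub : D ⊆ stdSimplex ℝ S)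
    (hD : ∀ᵐ ω ∂μ, ∀ t s a, pomrlModel σ (fun j => X j ω) t s a ∈ D) :
    1 ≤ Metric.diam D ∨ ∀ᵐ ω ∂μ, ∀ t, pomrlModel σ (fun j => X j ω) t = P t ω := by
  -- The two next states may come from different state-action pairs, since `D` is common to all of
  -- them.
  by_cases hc : ∃ s a y s' a' y', (¬ ∀ᵐ p ∂law, p s a y = 0) ∧
      (¬ ∀ᵐ p ∂law, p s' a' y' = 0) ∧ y ≠ y'
  · left
    obtain ⟨s, a, y, s', a', y', hy, hy', hne⟩ := hc
    have hbdd : Bornology.IsBounded D := (isCompact_stdSimplex ℝ S).isBounded.subset hDsub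
    refine le_trans ?_ (Metric.dist_le_diam_of_mem hbdd
      (h.single_mem_of_charged hlaw hm hT hD hy) (h.single_mem_of_charged hlaw hm hT hD hy'))
    refine le_trans ?_ (dist_le_pi_dist _ _ y)
    simp [hne]
  · right
    have := h.isProbabilityMeasure_law ⟨0, hT⟩
    obtain ⟨s₀⟩ := ‹Nonempty S›
    obtain ⟨a₀⟩ := ‹Nonempty A›
    obtain ⟨y₀, hy₀⟩ : ∃ y, ¬ ∀ᵐ p ∂law, p s₀ a₀ y = 0 := by
      by_contra! hall
      obtain ⟨p, hp, hmod⟩ := ((ae_all_iff.2 hall).and hlaw.model).exists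
      simpa [hp] using (hmod s₀ a₀).2
    have hzero : ∀ s a y, y ≠ y₀ → ∀ᵐ p ∂law, p s a y = 0 := by
      intro s a y hy
      by_contra hcon
      exact hc ⟨s, a, y, s₀, a₀, y₀, hcon, hy₀, hy⟩
    have hP : ∀ᵐ ω ∂μ, ∀ t s a, P t ω s a = Pi.single y₀ 1 := by
      refine ae_all_iff.2 fun t => ae_all_iff.2 fun s => ae_all_iff.2 fun a => ?_
      have h1 : ∀ᵐ p ∂law, ∀ y, y ≠ y₀ → p s a y = 0 :=
        ae_all_iff.2 fun y => by
          by_cases hy : y = y₀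
          · simp [hy]
          · filter_upwards [hzero s a y hy] with p hp _ using hp
      rw [← h.law_model t] at h1
      filter_upwards [ae_of_ae_map (h.measurable_model t).aemeasurable h1, h.ae_model hlaw t]
        with ω hω hmod
      have hsum := (hmod s a).2
      rw [sum_eq_single y₀ (fun y _ hy => hω y hy) (by simp)] at hsum
      ext y
      by_cases hy : y = y₀
      · subst hy; simpa using hsum
      · simp [hy, hω y hy]
    have hX : ∀ᵐ ω ∂μ, ∀ t s a, X t ω s a = fun _ => y₀ := by
      refine ae_all_iff.2 fun t => ae_all_iff.2 fun s => ae_all_iff.2 fun a => ?_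
      have h1 : ∀ᵐ ω ∂μ, ∀ x : Fin m → S, (x ≠ fun _ => y₀) → X t ω s a ≠ x := by
        refine ae_all_iff.2 fun x => ?_
        by_cases hx : x = fun _ => y₀
        · simp [hx]
        obtain ⟨i, hi⟩ : ∃ i, x i ≠ y₀ := by
          by_contra! hcon
          exact hx (funext hcon)
        have h2 : μ {ω | P t ω ∈ Set.univ ∧ X t ω s a = x} = 0 := by
          rw [h.law_sample t s a x _ MeasurableSet.univ, Measure.restrict_univ]
          refine (lintegral_congr_ae ?_).trans lintegral_zero
          filter_upwards [hzero s a (x i) hi] with p hp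
          exact prod_eq_zero (mem_univ i) (by simp [hp])
        refine measure_mono_null (fun ω hω => ?_) h2
        simp only [Set.mem_compl_iff, Set.mem_ofPred_eq] at hω
        push Not at hω
        exact ⟨trivial, hω.2⟩
      filter_upwards [h1] with ω hω
      by_contra hcon
      exact hω _ hcon rfl
    filter_upwards [hP, hX] with ω h1 h2 t
    ext1 s
    ext1 a
    rw [h1, pomrlModel_of_const hm fun t => h2 t s a]

end IsTaskStream

end Feasible

/-! ### Tail bounds and the union over tasks and entries -/

section UnionBound

open MeasureTheory ProbabilityTheory Finset
open scoped ENNReal NNReal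

variable {S A Ω : Type*} {m T : ℕ} [Fintype S] [DecidableEq S]
  [MeasurableSpace S] [DiscreteMeasurableSpace S] [MeasurableSpace Ω] {μ : Measure Ω}
  {law : Measure (TransitionModel S A)} {P : Fin T → Ω → TransitionModel S A}
  {X : Fin T → Ω → S → A → Fin m → S} {Po : TransitionModel S A} {σ : ℝ}

/-- A two-sided sub-Gaussian tail bound. -/
lemma ProbabilityTheory.HasSubgaussianMGF.measure_abs_gt_le [IsFiniteMeasure μ] {Z : Ω → ℝ}
    {c : ℝ≥0} (hZ : HasSubgaussianMGF Z c μ) (hc : 0 < c) {L : ℝ} (hL : 0 ≤ L) :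
    μ {ω | √(4 * c * L) < |Z ω|} ≤ ENNReal.ofReal (2 * Real.exp (-(2 * L))) := by
  have hc' : (0 : ℝ) < c := hc
  -- The factor `4` in the threshold doubles the exponent to `2L`; the resulting square of `δ /
  -- (TSA)` later absorbs the second factor `S` of the union bound.
  have hexp : -√(4 * c * L) ^ 2 / (2 * c) = -(2 * L) := by
    rw [Real.sq_sqrt (by positivity)]
    field_simp
    ring
  have h1 := hZ.measure_ge_le (Real.sqrt_nonneg (4 * c * L))
  have h2 := hZ.neg.measure_ge_le (Real.sqrt_nonneg (4 * c * L))
  rw [hexp] at h1 h2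
  calc μ {ω | √(4 * c * L) < |Z ω|}
      ≤ μ ({ω | √(4 * c * L) ≤ Z ω} ∪ {ω | √(4 * c * L) ≤ (-Z) ω}) := by
        refine measure_mono fun ω hω => ?_
        exact (lt_abs.1 hω).imp (fun h => h.le) fun h => show _ ≤ -Z ω from h.le
    _ = ENNReal.ofReal (μ.real ({ω | √(4 * c * L) ≤ Z ω} ∪ {ω | √(4 * c * L) ≤ (-Z) ω})) :=
        (ofReal_measureReal).symm
    _ ≤ _ := ENNReal.ofReal_le_ofReal (by
        linarith [measureReal_union_le (μ := μ) {ω | √(4 * c * L) ≤ Z ω}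
          {ω | √(4 * c * L) ≤ (-Z) ω}])

/-- With high probability all empirical models are close to the true models, and their running
averages are close to the mean model. -/
lemma IsTaskStream.exists_bad_event [Fintype A] [IsProbabilityMeasure μ]
    (h : IsTaskStream μ law P X) (hlaw : TaskSimilarity law Po σ) (hm : 1 ≤ m) {L : ℝ}
    (hL : 0 ≤ L) :
    ∃ B : Set Ω, MeasurableSet B ∧
      μ B ≤ ENNReal.ofReal
        (T * Fintype.card S * Fintype.card A * Fintype.card S * (4 * Real.exp (-(2 * L)))) ∧
      ∀ ω ∉ B, ∀ t s a y,
        |empiricalModel (X t ω) s a y - P t ω s a y| ≤ √(4 * (1 / (4 * m)) * L) ∧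
        |∑ j ∈ Iio t, (empiricalModel (X j ω) s a y - Po s a y)| ≤
          √(4 * ((t : ℕ) * (1 / (4 * m) + σ.toNNReal ^ 2)) * L) := by
  let B₁ : Fin T × S × A × S → Set Ω := fun i =>
    {ω | √(4 * (1 / (4 * m)) * L) <
      |empiricalModel (X i.1 ω) i.2.1 i.2.2.1 i.2.2.2 - P i.1 ω i.2.1 i.2.2.1 i.2.2.2|}
  let B₂ : Fin T × S × A × S → Set Ω := fun i =>
    {ω | √(4 * ((i.1 : ℕ) * (1 / (4 * m) + σ.toNNReal ^ 2)) * L) <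
      |∑ j ∈ Iio i.1, (empiricalModel (X j ω) i.2.1 i.2.2.1 i.2.2.2 - Po i.2.1 i.2.2.1 i.2.2.2)|}
  have hm0 : (0 : ℝ≥0) < 1 / (4 * m) := by
    have : (0 : ℝ≥0) < m := by exact_mod_cast hm
    positivity
  have hB₁ : ∀ i, μ (B₁ i) ≤ ENNReal.ofReal (2 * Real.exp (-(2 * L))) := by
    rintro ⟨t, s, a, y⟩
    simpa [B₁] using (h.hasSubgaussianMGF_noise hlaw hm t s a y).measure_abs_gt_le hm0 hL
  have hB₂ : ∀ i, μ (B₂ i) ≤ ENNReal.ofReal (2 * Real.exp (-(2 * L))) := by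
    rintro ⟨t, s, a, y⟩
    -- With no previous task, the sum and its threshold both vanish and the bad event is empty; the
    -- tail bound needs a positive proxy.
    by_cases ht : (t : ℕ) = 0
    · have : Iio t = ∅ := card_eq_zero.1 (by simp [ht])
      simp [B₂, this, ht]
    · have hsum := HasSubgaussianMGF.sum_of_iIndepFun (h.iIndepFun_deviation (Po := Po) s a y)
        (c := fun _ => 1 / (4 * m) + σ.toNNReal ^ 2) (s := Iio t)
        fun j _ => h.hasSubgaussianMGF_deviation hlaw hm j s a y
      rw [sum_const, Fin.card_Iio, nsmul_eq_mul] at hsum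
      have ht' : (0 : ℝ≥0) < (t : ℕ) := by exact_mod_cast Nat.pos_of_ne_zero ht
      have := hsum.measure_abs_gt_le (mul_pos ht' (add_pos_of_pos_of_nonneg hm0 zero_le)) hL
      push_cast at this
      exact this
  refine ⟨⋃ i, (B₁ i ∪ B₂ i), MeasurableSet.iUnion fun i => MeasurableSet.union ?_ ?_, ?_, ?_⟩
  · exact measurableSet_lt measurable_const (h.measurable_noise i.1 _ _ _).abs
  · exact measurableSet_lt measurable_const
      (Finset.measurable_fun_sum _ fun j _ => h.measurable_deviation j _ _ _).abs
  · calc μ (⋃ i, (B₁ i ∪ B₂ i)) ≤ ∑ i, μ (B₁ i ∪ B₂ i) := measure_iUnion_fintype_le _ _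
      _ ≤ ∑ _i : Fin T × S × A × S, ENNReal.ofReal (4 * Real.exp (-(2 * L))) := by
          refine sum_le_sum fun i _ => (measure_union_le _ _).trans
            ((add_le_add (hB₁ i) (hB₂ i)).trans (le_of_eq ?_))
          rw [← ENNReal.ofReal_add (by positivity) (by positivity)]
          congr 1
          ring
      _ = _ := by
          rw [sum_const, card_univ, nsmul_eq_mul, ← ENNReal.ofReal_natCast,
            ← ENNReal.ofReal_mul (by positivity)]
          congr 2
          simp only [Fintype.card_prod, Fintype.card_fin]
          push_cast
          ring
  · intro ω hω t s a y
    simp only [Set.mem_iUnion, Set.mem_union, not_exists, not_or] at hω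
    exact ⟨not_lt.1 (hω (t, s, a, y)).1, not_lt.1 (hω (t, s, a, y)).2⟩

/-- The failure probability of the union bound. -/
lemma union_bound_le {t s a δ : ℝ} (ht : 1 ≤ t) (hs : 1 ≤ s) (ha : 1 ≤ a) (hδ0 : 0 < δ)
    (hδ1 : δ < 1) :
    t * s * a * s * (4 * Real.exp (-(2 * (1 + Real.log (t * s * a / δ))))) ≤ δ := by
  have hz : 0 < t * s * a / δ := by positivity
  -- The summand `1` in `L` pays for the factor `4`, because `e² ≥ 4`.
  have h4 : 4 * Real.exp (-2) ≤ 1 := by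
    have h1 := Real.add_one_le_exp (1 : ℝ)
    have h2 : (4 : ℝ) ≤ Real.exp 2 := by
      rw [show (2 : ℝ) = 1 + 1 by norm_num, Real.exp_add]
      nlinarith
    rw [Real.exp_neg]
    exact mul_inv_le_one_of_le₀ h2 (Real.exp_pos 2).le
  have hexp : Real.exp (-(2 * (1 + Real.log (t * s * a / δ)))) =
      Real.exp (-2) * (δ / (t * s * a)) ^ 2 := by
    rw [show -(2 * (1 + Real.log (t * s * a / δ))) =
      -2 + (2 : ℕ) * -Real.log (t * s * a / δ) by push_cast; ring, Real.exp_add, Real.exp_nat_mul,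
      Real.exp_neg (Real.log _), Real.exp_log hz, inv_div]
  rw [hexp]
  calc t * s * a * s * (4 * (Real.exp (-2) * (δ / (t * s * a)) ^ 2))
      = (4 * Real.exp (-2)) * (δ ^ 2 / (t * a)) := by field_simp
    _ ≤ 1 * (δ ^ 2 / 1) := by
        gcongr
        nlinarith
    _ ≤ δ := by nlinarith

end UnionBound

/-! ### From error bounds to the rate -/

section Rate

open Finset

/-- Telescoping with `1/√(k+1) ≤ 2√(k+1) - 2√k`. The term `k = 0` is `0` by the convention on
division. -/
lemma sum_range_one_div_sqrt_le (n : ℕ) : ∑ k ∈ range n, 1 / √(k : ℝ) ≤ 2 * √(n : ℝ) := by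
  have key : ∀ n : ℕ, ∑ k ∈ range (n + 1), 1 / √(k : ℝ) ≤ 2 * √(n : ℝ) := by
    intro n
    induction n with
    | zero => simp
    | succ n ih =>
      rw [sum_range_succ]
      have hx : 0 ≤ √(n : ℝ) := Real.sqrt_nonneg _
      have hy : 0 < √((n + 1 : ℕ) : ℝ) := Real.sqrt_pos.2 (by positivity)
      have h1 : √(n : ℝ) ^ 2 = n := Real.sq_sqrt (by positivity)
      have h2 : √((n + 1 : ℕ) : ℝ) ^ 2 = n + 1 := by
        rw [Real.sq_sqrt (by positivity)]; push_cast; ring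
      have h3 : 1 / √((n + 1 : ℕ) : ℝ) ≤ 2 * √((n + 1 : ℕ) : ℝ) - 2 * √(n : ℝ) := by
        rw [div_le_iff₀ hy]
        nlinarith [sq_nonneg (√((n + 1 : ℕ) : ℝ) - √(n : ℝ))]
      linarith
  cases n with
  | zero => simp
  | succ n =>
    refine (key n).trans ?_
    gcongr
    simp

variable {S A : Type*} {m T : ℕ} {σ : ℝ}

lemma mixingRate_nonneg (n : ℕ) : 0 ≤ mixingRate σ m n := by
  rw [mixingRate]
  split_ifs <;> positivity

lemma mixingRate_le_one (n : ℕ) : mixingRate σ m n ≤ 1 := by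
  rw [mixingRate]
  split_ifs
  · norm_num
  · exact div_le_one_of_le₀ (by linarith [show 0 ≤ σ ^ 2 * (1 + 1 / (n : ℝ)) * m by positivity])
      (by positivity)

lemma mixingRate_le {n : ℕ} (hn : n ≠ 0) : mixingRate σ m n ≤ 1 / (σ ^ 2 * m + 1) := by
  rw [mixingRate, if_neg hn]
  refine one_div_le_one_div_of_le (by positivity) ?_
  have : 0 ≤ σ ^ 2 * (1 / (n : ℝ)) * m := by positivity
  linarith

/-- With `x = σ²m` and `u = x/n ≤ x`, the left side is `(x+u)/(x+u+1)`; the factor `2` comes from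
the worst case `n = 1`. -/
lemma one_sub_mixingRate_le {n : ℕ} (hn : n ≠ 0) :
    1 - mixingRate σ m n ≤ 2 * (σ ^ 2 * m) / (σ ^ 2 * m + 1) := by
  rw [mixingRate, if_neg hn]
  have hn1 : 1 / (n : ℝ) ≤ 1 :=
    div_le_one_of_le₀ (by exact_mod_cast Nat.one_le_iff_ne_zero.2 hn) (by positivity)
  have hx : 0 ≤ σ ^ 2 * m := by positivity
  have hu : 0 ≤ σ ^ 2 * m * (1 / (n : ℝ)) := by positivity
  have hu' : σ ^ 2 * m * (1 / (n : ℝ)) ≤ σ ^ 2 * m := mul_le_of_le_one_right hx hn1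
  rw [show σ ^ 2 * (1 + 1 / (n : ℝ)) * m = σ ^ 2 * m + σ ^ 2 * m * (1 / (n : ℝ)) by ring]
  generalize σ ^ 2 * m * (1 / (n : ℝ)) = u at *
  generalize σ ^ 2 * m = x at *
  rw [one_sub_div (by positivity), div_le_div_iff₀ (by positivity) (by positivity)]
  nlinarith

/-- The error of the estimated model in terms of the sampling noise of the current task and of the
deviation of the running average of the previous tasks. -/
lemma abs_sub_pomrlModel_le [Fintype S] [DecidableEq S] {p Po : TransitionModel S A}
    {x : Fin T → S → A → Fin m → S} {t : Fin T} {s : S} {a : A} {y : S} {r₁ r₂ : ℝ}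
    (hσ : |p s a y - Po s a y| ≤ σ) (h1 : |empiricalModel (x t) s a y - p s a y| ≤ r₁)
    (h2 : |∑ j ∈ Iio t, (empiricalModel (x j) s a y - Po s a y)| ≤ √((t : ℕ) : ℝ) * r₂)
    (hr₂ : 0 ≤ r₂) :
    |p s a y - pomrlModel σ x t s a y| ≤
      (if (t : ℕ) = 0 then r₁ else 0) + 2 * (σ ^ 2 * m) / (σ ^ 2 * m + 1) * r₁ +
        1 / (σ ^ 2 * m + 1) * (σ + r₂ * (1 / √((t : ℕ) : ℝ))) := by
  have hσ0 : 0 ≤ σ := (abs_nonneg _).trans hσ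
  have hr₁ : 0 ≤ r₁ := (abs_nonneg _).trans h1
  by_cases ht : (t : ℕ) = 0
  · rw [if_pos ht]
    have : pomrlModel σ x t s a y = empiricalModel (x t) s a y := by
      simp [pomrlModel, mixingRate, ht]
    rw [this, abs_sub_comm, add_assoc]
    exact le_add_of_le_of_nonneg h1 (by positivity)
  · rw [if_neg ht, zero_add]
    have ht0 : (0 : ℝ) < (t : ℕ) := by exact_mod_cast Nat.pos_of_ne_zero ht
    have hst : 0 < √((t : ℕ) : ℝ) := Real.sqrt_pos.2 ht0
    have hinit : metaInit x t s a y - Po s a y =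
        (∑ j ∈ Iio t, (empiricalModel (x j) s a y - Po s a y)) / (t : ℕ) := by
      rw [metaInit, if_neg ht, sum_sub_distrib, sum_const, Fin.card_Iio, nsmul_eq_mul]
      field_simp
    have h3 : |metaInit x t s a y - Po s a y| ≤ r₂ * (1 / √((t : ℕ) : ℝ)) := by
      rw [hinit, abs_div, abs_of_pos ht0, div_le_iff₀ ht0]
      refine h2.trans (le_of_eq ?_)
      have : √((t : ℕ) : ℝ) * √((t : ℕ) : ℝ) = (t : ℕ) := Real.mul_self_sqrt ht0.le
      field_simp
      nlinarith
    have h4 : |p s a y - metaInit x t s a y| ≤ σ + r₂ * (1 / √((t : ℕ) : ℝ)) := by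
      rw [show p s a y - metaInit x t s a y =
        (p s a y - Po s a y) - (metaInit x t s a y - Po s a y) by ring]
      exact (abs_sub _ _).trans (add_le_add hσ h3)
    have hα := mixingRate_nonneg (σ := σ) (m := m) t
    have hα1 : 0 ≤ 1 - mixingRate σ m t := sub_nonneg.2 (mixingRate_le_one _)
    rw [show p s a y - pomrlModel σ x t s a y =
      -((1 - mixingRate σ m t) * (empiricalModel (x t) s a y - p s a y)) +
        mixingRate σ m t * (p s a y - metaInit x t s a y) by rw [pomrlModel]; ring]
    refine (abs_add_le _ _).trans (add_le_add ?_ ?_)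
    · rw [abs_neg, abs_mul, abs_of_nonneg hα1]
      exact mul_le_mul (one_sub_mixingRate_le ht) h1 (abs_nonneg _) (by positivity)
    · rw [abs_mul, abs_of_nonneg hα]
      exact mul_le_mul (mixingRate_le ht) h4 (abs_nonneg _) (by positivity)

/-- The task average of the error bounds is of the order of the rate. -/
lemma average_error_le (hT : 1 ≤ T) (hm : 1 ≤ m) (hσ : 0 ≤ σ) {D L : ℝ} (hD : 1 ≤ D)
    (hL : 1 ≤ L) :
    1 / (T : ℝ) * ∑ t : Fin T, ((if (t : ℕ) = 0 then √(L / m) else 0) +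
        2 * (σ ^ 2 * m) / (σ ^ 2 * m + 1) * √(L / m) +
        1 / (σ ^ 2 * m + 1) *
          (σ + √(4 * (1 / (4 * m) + σ ^ 2) * L) * (1 / √((t : ℕ) : ℝ)))) ≤
      5 * L * pomrlRate σ D m T := by
  have hT0 : (0 : ℝ) < T := by exact_mod_cast hT
  have hm0 : (0 : ℝ) < m := by exact_mod_cast hm
  have hsL : √L ≤ L := Real.sqrt_le_iff.2 ⟨by linarith, by nlinarith⟩
  set w := √(D / m) with hw
  set v := √(σ ^ 2 + D / m) with hv
  have hw0 : 0 ≤ w := Real.sqrt_nonneg _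
  have hv0 : 0 ≤ v := Real.sqrt_nonneg _
  have hwv : w ≤ v := Real.sqrt_le_sqrt (by linarith [sq_nonneg σ])
  -- Here, and again in `h2`, `1 ≤ D` brings the diameter into a bound that did not contain it.
  have h1 : √(L / m) ≤ L * w := by
    calc √(L / m) = √L * √(1 / m) := by rw [← Real.sqrt_mul (by linarith)]; congr 1; ring
      _ ≤ L * w := by
        refine mul_le_mul hsL (Real.sqrt_le_sqrt ?_) (Real.sqrt_nonneg _) (by linarith)
        gcongr
  have h2 : √(4 * (1 / (4 * m) + σ ^ 2) * L) ≤ 2 * L * v := by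
    calc √(4 * (1 / (4 * m) + σ ^ 2) * L) = √L * √(4 * (1 / (4 * m) + σ ^ 2)) := by
          rw [← Real.sqrt_mul (by linarith)]; congr 1; ring
      _ ≤ L * (2 * v) := by
        refine mul_le_mul hsL ?_ (Real.sqrt_nonneg _) (by linarith)
        rw [show 2 * v = √(4 * (σ ^ 2 + D / m)) by
          rw [Real.sqrt_mul (by norm_num), show (4 : ℝ) = 2 ^ 2 by norm_num,
            Real.sqrt_sq (by norm_num)]]
        refine Real.sqrt_le_sqrt ?_
        have : 1 / (4 * (m : ℝ)) ≤ D / m := by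
          rw [div_le_div_iff₀ (by positivity) hm0]
          nlinarith
        linarith
      _ = 2 * L * v := by ring
  have hfirst : ∑ t : Fin T, (if (t : ℕ) = 0 then √(L / m) else 0) = √(L / m) := by
    rw [Fin.sum_univ_eq_sum_range fun t => if t = 0 then √(L / (m : ℝ)) else 0]
    simp [show T ≠ 0 by omega]
  have hsq : ∑ t : Fin T, 1 / √((t : ℕ) : ℝ) ≤ 2 * √(T : ℝ) := by
    rw [Fin.sum_univ_eq_sum_range fun t => 1 / √(t : ℝ)]
    exact sum_range_one_div_sqrt_le T
  set z := √(1 / (T : ℝ)) with hz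
  have hz0 : 0 ≤ z := Real.sqrt_nonneg _
  have hzT : √(T : ℝ) = T * z := by
    rw [hz, Real.sqrt_div zero_le_one, Real.sqrt_one]
    have := Real.mul_self_sqrt hT0.le
    have : √(T : ℝ) ≠ 0 := (Real.sqrt_pos.2 hT0).ne'
    field_simp
    linarith
  have hz1 : 1 / (T : ℝ) ≤ z := by
    have hz2 : z * z = 1 / T := Real.mul_self_sqrt (by positivity)
    have : z ≤ 1 := Real.sqrt_le_one.2 (div_le_one_of_le₀ (by exact_mod_cast hT) hT0.le)
    nlinarith
  have hz1' : z ≤ 1 := Real.sqrt_le_one.2 (div_le_one_of_le₀ (by exact_mod_cast hT) hT0.le)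
  rw [sum_add_distrib, sum_add_distrib, hfirst, sum_const, ← mul_sum, sum_add_distrib, sum_const,
    ← mul_sum, card_univ, Fintype.card_fin, nsmul_eq_mul, nsmul_eq_mul]
  have hx0 : 0 ≤ σ ^ 2 * m := by positivity
  set r₁ := √(L / m)
  set r₂ := √(4 * (1 / (4 * m) + σ ^ 2) * L)
  have hr₂ : 0 ≤ r₂ := Real.sqrt_nonneg _
  calc _ ≤ 1 / (T : ℝ) * (r₁ + T * (2 * (σ ^ 2 * m) / (σ ^ 2 * m + 1) * r₁) +
        1 / (σ ^ 2 * m + 1) * (T * σ + r₂ * (2 * √(T : ℝ)))) := by gcongr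
    _ = 1 / (T : ℝ) * r₁ + 2 * (σ ^ 2 * m) / (σ ^ 2 * m + 1) * r₁ +
        1 / (σ ^ 2 * m + 1) * (σ + r₂ * (2 * z)) := by
        rw [hzT]
        field_simp
    _ ≤ z * (L * w) + 2 * (σ ^ 2 * m) / (σ ^ 2 * m + 1) * (L * w) +
        1 / (σ ^ 2 * m + 1) * (σ + 2 * L * v * (2 * z)) := by gcongr
    _ ≤ 5 * L * pomrlRate σ D m T := by
        rw [pomrlRate, ← hw, ← hv, ← hz]
        generalize σ ^ 2 * (m : ℝ) = x at *
        have e1 : z * (L * w) + 2 * x / (x + 1) * (L * w) +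
            1 / (x + 1) * (σ + 2 * L * v * (2 * z)) =
          (z * (L * w) * (x + 1) + 2 * x * (L * w) + (σ + 2 * L * v * (2 * z))) / (x + 1) := by
          field_simp
        rw [e1, ← add_div, ← mul_div_assoc]
        refine div_le_div_of_nonneg_right ?_ (by positivity)
        -- The first-task term `z * (L * w) * (x + 1)` is split: the part without `x` goes to `L *
        -- (z * v)` by `w ≤ v`, the other to `L * (x * w)` by `z ≤ 1`. The largest total coefficient
        -- is that of `L * (z * v)`, namely `1 + 4 = 5`.
        have a1 : z * (L * w) ≤ L * (z * v) := by
          rw [show z * (L * w) = L * (z * w) by ring]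
          gcongr
        have a2 : z * (L * w) * x ≤ L * (x * w) := by
          rw [show z * (L * w) * x = z * (L * (x * w)) by ring]
          exact mul_le_of_le_one_left (by positivity) hz1'
        have a3 : σ ≤ L * σ := le_mul_of_one_le_left hσ hL
        have a4 : 0 ≤ L * (z * σ) := by positivity
        have a5 : 0 ≤ L * (x * w) := by positivity
        have a6 : 0 ≤ L * σ := by positivity
        linarith

end Rate

/-! ### Assembly of the average loss bound -/

section Assembly

open MeasureTheory Finset

/-- The average planning loss in terms of entrywise bounds on the errors of the models. -/
lemma avgPlanningLoss_le {S A : Type*} [Fintype S] [DecidableEq S] {T : ℕ} (hT : 1 ≤ T)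
    {P Q : Fin T → TransitionModel S A} {R : S → A → ℝ}
    (hP : ∀ t s a, P t s a ∈ stdSimplex ℝ S) (hQ : ∀ t s a, Q t s a ∈ stdSimplex ℝ S)
    (hR : ∀ s a, R s a ∈ Set.Icc (0 : ℝ) 1) {γ γeval : ℝ} (hγ0 : 0 ≤ γ) (hγ : γ ≤ γeval)
    (hγ1 : γeval < 1) {ε : Fin T → ℝ} (hε0 : ∀ t, 0 ≤ ε t)
    (hε : ∀ t s a y, |P t s a y - Q t s a y| ≤ ε t) {b : ℝ}
    (hb : 1 / (T : ℝ) * ∑ t, ε t ≤ b) {πstar πhat : Fin T → S → A}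
    (hstar : ∀ t, IsOptimalPolicy (P t) R γeval (πstar t))
    (hhat : ∀ t, IsOptimalPolicy (Q t) R γ (πhat t)) :
    avgPlanningLoss P R γeval πstar πhat ≤
      (γeval - γ) / ((1 - γeval) * (1 - γ)) +
        2 * γ * (Fintype.card S : ℝ) / (1 - γ) ^ 2 * b := by
  have hT0 : (T : ℝ) ≠ 0 := by positivity
  calc avgPlanningLoss P R γeval πstar πhat
      ≤ 1 / (T : ℝ) * ∑ t, ((γeval - γ) / ((1 - γeval) * (1 - γ)) +
          2 * γ * (Fintype.card S : ℝ) / (1 - γ) ^ 2 * ε t) :=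
        mul_le_mul_of_nonneg_left (sum_le_sum fun t _ => norm_valueFn_sub_le (hP t) (hQ t) hR
          hγ0 hγ hγ1 (hε0 t) (hε t) (hstar t) (hhat t)) (by positivity)
    _ = (γeval - γ) / ((1 - γeval) * (1 - γ)) +
          2 * γ * (Fintype.card S : ℝ) / (1 - γ) ^ 2 * (1 / (T : ℝ) * ∑ t, ε t) := by
        rw [sum_add_distrib, sum_const, card_univ, Fintype.card_fin, nsmul_eq_mul, ← mul_sum,
          mul_add, ← mul_assoc, one_div_mul_cancel hT0, one_mul]
        ring
    _ ≤ _ := by gcongr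

/-- A null set can be removed from the complement of an unlikely event. -/
lemma exists_measurableSet_of_bad_event {Ω : Type*} [MeasurableSpace Ω] {μ : Measure Ω}
    [IsProbabilityMeasure μ] {B : Set Ω} (hB : MeasurableSet B) {δ : ℝ}
    (hδ : 0 ≤ δ) (hμ : μ B ≤ ENNReal.ofReal δ) {p : Ω → Prop} (hp : ∀ᵐ ω ∂μ, p ω) :
    ∃ E : Set Ω, MeasurableSet E ∧ ENNReal.ofReal (1 - δ) ≤ μ E ∧ ∀ ω ∈ E, ω ∉ B ∧ p ω := by
  obtain ⟨N, hN, hNm, hN0⟩ := exists_measurable_superset_of_null (ae_iff.1 hp)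
  refine ⟨(B ∪ N)ᶜ, (hB.union hNm).compl, ?_, fun ω hω => ?_⟩
  · rw [prob_compl_eq_one_sub (hB.union hNm), ENNReal.ofReal_sub _ hδ, ENNReal.ofReal_one]
    refine tsub_le_tsub_left ((measure_union_le _ _).trans ?_) _
    rwa [hN0, add_zero]
  · rw [Set.mem_compl_iff, Set.mem_union, not_or] at hω
    exact ⟨hω.1, by_contra fun h => hω.2 (hN h)⟩

end Assembly

theorem theorem2 :
    -- universal constant and exponent hidden by the `Õ`
    ∃ (C : ℝ) (k : ℕ), 0 < C ∧
    ∀ (S A Ω : Type*) [Fintype S] [DecidableEq S] [Nonempty S]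
      [MeasurableSpace S] [DiscreteMeasurableSpace S] [Fintype A] [Nonempty A]
      [MeasurableSpace Ω] (μ : MeasureTheory.Measure Ω) [MeasureTheory.IsProbabilityMeasure μ]
      (T m : ℕ) (_ : 1 ≤ T) (_ : 1 ≤ m)
      (R : S → A → ℝ) (_ : ∀ s a, R s a ∈ Set.Icc (0 : ℝ) 1)
      (γ γeval : ℝ) (_ : 0 ≤ γ) (_ : γ ≤ γeval) (_ : γeval < 1)
      (σ : ℝ) (_ : 0 ≤ σ) (_ : σ ^ 2 < 1)
      (δ : ℝ) (_ : 0 < δ) (_ : δ < 1)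
      -- the task distribution, its mean model, the tasks and their samples
      (law : MeasureTheory.Measure (TransitionModel S A)) (Po : TransitionModel S A)
      (_ : TaskSimilarity law Po σ)
      (P : Fin T → Ω → TransitionModel S A) (X : Fin T → Ω → S → A → Fin m → S)
      (_ : IsTaskStream μ law P X)
      -- the set of feasible models, which contains the true and the estimated models
      (D : Set (S → ℝ)) (_ : D ⊆ stdSimplex ℝ S)
      (_ : ∀ᵐ ω ∂μ, ∀ t s a, P t ω s a ∈ D)
      (_ : ∀ᵐ ω ∂μ, ∀ t s a, pomrlModel σ (fun j => X j ω) t s a ∈ D),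
    ∃ E : Set Ω, MeasurableSet E ∧ ENNReal.ofReal (1 - δ) ≤ μ E ∧
      ∀ ω ∈ E, ∀ πstar πhat : Fin T → S → A,
        (∀ t, IsOptimalPolicy (P t ω) R γeval (πstar t)) →
        (∀ t, IsOptimalPolicy (pomrlModel σ (fun j => X j ω) t) R γ (πhat t)) →
        avgPlanningLoss (fun t => P t ω) R γeval πstar πhat ≤
          (γeval - γ) / ((1 - γeval) * (1 - γ)) +
            2 * γ * (Fintype.card S : ℝ) / (1 - γ) ^ 2 *
              (C * (1 + Real.log (T * Fintype.card S * Fintype.card A / δ)) ^ k *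
                pomrlRate σ (Metric.diam D) m T) := by
  -- The exponent `1` suffices since the tails produce `√L`, and `√L ≤ L`.
  refine ⟨5, 1, by norm_num, ?_⟩
  intro S A Ω _ _ _ _ _ _ _ _ μ _ T m hT hm R hR γ γeval hγ0 hγ hγ1 σ hσ0 _ δ hδ0 hδ1 law Po
    hlaw P X h D hDsub _ hDest
  have hT' : (1 : ℝ) ≤ T := by exact_mod_cast hT
  have hS : (1 : ℝ) ≤ Fintype.card S := by exact_mod_cast Fintype.card_pos
  have hA : (1 : ℝ) ≤ Fintype.card A := by exact_mod_cast Fintype.card_pos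
  have hTSA : (1 : ℝ) ≤ T * Fintype.card S * Fintype.card A :=
    one_le_mul_of_one_le_of_one_le (one_le_mul_of_one_le_of_one_le hT' hS) hA
  have hlog : 0 ≤ Real.log (T * Fintype.card S * Fintype.card A / δ) :=
    Real.log_nonneg ((one_le_div hδ0).2 (hδ1.le.trans hTSA))
  set L := 1 + Real.log (T * Fintype.card S * Fintype.card A / δ) with hLdef
  have hL : 1 ≤ L := by linarith
  rw [pow_one]
  have hmodel : ∀ᵐ ω ∂μ, ∀ t s a, P t ω s a ∈ stdSimplex ℝ S :=
    MeasureTheory.ae_all_iff.2 fun t => h.ae_model hlaw t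
  have hest : ∀ᵐ ω ∂μ, ∀ t s a, pomrlModel σ (fun j => X j ω) t s a ∈ stdSimplex ℝ S := by
    filter_upwards [hDest] with ω hω t s a using hDsub (hω t s a)
  have hclose : ∀ᵐ ω ∂μ, ∀ t s a, ‖P t ω s a - Po s a‖ ≤ σ :=
    MeasureTheory.ae_all_iff.2 fun t => h.ae_norm_sub_le hlaw t
  rcases h.one_le_diam_or_ae_pomrlModel_eq hlaw hm hT hDsub hDest with hD | hexact
  · obtain ⟨B, hBm, hBμ, hB⟩ := h.exists_bad_event hlaw hm (L := L) (by linarith)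
    obtain ⟨E, hEm, hEμ, hE⟩ := exists_measurableSet_of_bad_event hBm hδ0.le
      (hBμ.trans (ENNReal.ofReal_le_ofReal (union_bound_le hT' hS hA hδ0 hδ1)))
      (hmodel.and (hest.and hclose))
    refine ⟨E, hEm, hEμ, fun ω hω πstar πhat hstar hhat => ?_⟩
    obtain ⟨hωB, hωP, hωQ, hωσ⟩ := hE ω hω
    refine avgPlanningLoss_le hT hωP hωQ hR hγ0 hγ hγ1 (fun t => ?_) (fun t s a y => ?_)
      (average_error_le hT hm hσ0 hD hL) hstar hhat
    · positivity
    · obtain ⟨h1, h2⟩ := hB ω hωB t s a y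
      refine abs_sub_pomrlModel_le (Po := Po) ?_ (h1.trans (le_of_eq ?_))
        (h2.trans (le_of_eq ?_)) (Real.sqrt_nonneg _)
      · exact (norm_le_pi_norm (P t ω s a - Po s a) y).trans (hωσ t s a)
      · congr 1
        field_simp
      · rw [← Real.sqrt_mul (by positivity), Real.coe_toNNReal σ hσ0]
        congr 1
        ring
  -- Exact estimates: no bad event is needed, the errors are `0`, and the rate need only be
  -- nonnegative.
  · obtain ⟨E, hEm, hEμ, hE⟩ := exists_measurableSet_of_bad_event (μ := μ) MeasurableSet.empty
      hδ0.le (by simp) (hmodel.and (hest.and hexact))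
    refine ⟨E, hEm, hEμ, fun ω hω πstar πhat hstar hhat => ?_⟩
    obtain ⟨-, hωP, hωQ, hωeq⟩ := hE ω hω
    refine avgPlanningLoss_le hT hωP hωQ hR hγ0 hγ hγ1 (ε := fun _ => 0) (fun t => le_rfl)
      (fun t s a y => by simp [hωeq t]) ?_ hstar hhat
    rw [Finset.sum_const_zero, mul_zero, pomrlRate]
    positivity
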